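/- Let $\mathbb K\in\{\mathbb R,\mathbb C\}$ and $t_0<t_1$. Let $J,R,Q\in\mathbb K^{n\times n}$ and $B\in\mathbb K^{n\times m}$ with $J=-J^H$, $R=R^H\ge 0$, $Q=Q^H\ge 0$, and let $S\in\mathbb K^{m\times m}$ with $S=S^H\ge 0$. Put $$\mathcal E=\begin{bmatrix}0&I_n&0\\-I_n&0&0\\0&0&0\end{bmatrix},\qquad \mathcal A_S=\begin{bmatrix}0&(J-R)Q&B\\((J-R)Q)^H&QRQ&0\\B^H&0&S\end{bmatrix}\in\mathbb K^{(n+n+m)\times(n+n+m)}.$$ Let $\mu\in\mathbb K\setminus\big(\sigma((J-R)Q)\cup\sigma(-((J-R)Q)^H)\big)$ be such that $\mu\mathcal E-\mathcal A_S$ is invertible, and define $$E_\mu=\begin{bmatrix}0&(J-R)Q-\mu I\\((J-R)Q)^H+\mu I&QRQ\end{bmatrix}^{-1},\qquad S_\mu=S-\begin{bmatrix}B^H&0\end{bmatrix}E_\mu\begin{bmatrix}B\\0\end{bmatrix},$$ $$N_\mu=\Big(E_\mu+E_\mu\begin{bmatrix}B\\0\end{bmatrix}S_\mu^{-1}\begin{bmatrix}B^H&0\end{bmatrix}E_\mu\Big)\begin{bmatrix}0&-I\\I&0\end{bmatrix}\in\mathbb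 K^{2n\times 2n}.$$ Let $N_\mu^D$ be the Drazin inverse of $N_\mu$, that is, the unique matrix $X$ with $XN_\mu=N_\mu X$, $XN_\mu X=X$ and $XN_\mu^{\nu+1}=N_\mu^\nu$ for some $\nu\in\mathbb N_0$, and let $E_1,\dots,E_4:\mathbb R\to\mathbb K^{n\times n}$ be the blocks in $$\exp\big(-[N_\mu^D(I-\mu N_\mu)](t-t_0)\big)=\begin{bmatrix}E_1(t)&E_2(t)\\E_3(t)&E_4(t)\end{bmatrix},\qquad t\in\mathbb R.$$ Suppose that $E_3(t_1)$ is invertible, and let $x^0,x^1\in\mathbb K^n$. Then the differential-algebraic equation $$\frac{\mathrm d}{\mathrm dt}\,\mathcal E\begin{bmatrix}\lambda\\x\\u\end{bmatrix}=\mathcal A_S\begin{bmatrix}\lambda\\x\\u\end{bmatrix}\quad\text{on }[t_0,t_1]$$ has a solution $(\lambda,x,u)\in\mathcal C^1([t_0,t_1],\mathbb K^{n+n+m})$ with $x(t_0)=x^0$ and $x(t_1)=x^1$ if and only if $$\begin{bmatrix}E_3(t_1)^{-1}[x^1-E_4(t_1)x^0]\\x^0\end{bmatrix}\in\operatorname{im}(N_\mu^DN_\mu).$$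 Here a function belongs to $\mathcal C^1([t_0,t_1],\mathbb K^{N})$ if it is the restriction to $[t_0,t_1]$ of a continuously differentiable function on an open interval $(t_0-\varepsilon,t_1+\varepsilon)$ with some $\varepsilon>0$. -/

import Mathlib

open scoped ComplexOrder Matrix

noncomputable section

/-- `X` is a Drazin inverse of the square matrix `M`. -/
structure IsDrazinInverse {K ι : Type*} [Field K] [Fintype ι] [DecidableEq ι]
    (M X : Matrix ι ι K) : Prop where
  comm : X * M = M * X
  outer : X * M * X = X
  index : ∃ ν : ℕ, X * M ^ (ν + 1) = M ^ ν

/-- Every square matrix over a field has exactly one Drazin inverse. -/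
theorem existsUnique_isDrazinInverse {K ι : Type*} [Field K] [Fintype ι] [DecidableEq ι]
    (M : Matrix ι ι K) : ∃! X : Matrix ι ι K, IsDrazinInverse M X := by
  have key : ∃ (k : ℕ) (s : Matrix ι ι K), Commute M s ∧ M ^ k = M ^ (k + 1) * s := by
    obtain ⟨q, hq, hq0⟩ := Polynomial.exists_eq_pow_rootMultiplicity_mul_and_not_dvd
      M.charpoly M.charpoly_monic.ne_zero 0
    set k := M.charpoly.rootMultiplicity 0
    have hc : q.coeff 0 ≠ 0 := by
      intro h
      apply hq0
      rw [Polynomial.C_0, sub_zero]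
      exact Polynomial.X_dvd_iff.mpr h
    have h0 : M ^ k * Polynomial.aeval M q = 0 := by
      have := M.aeval_self_charpoly
      rw [hq] at this
      simpa using this
    have hcm : Commute M (Polynomial.aeval M q.divX) := by
      have h1 : Polynomial.aeval M (Polynomial.X * q.divX)
          = Polynomial.aeval M (q.divX * Polynomial.X) := by rw [mul_comm]
      simpa [Commute, SemiconjBy] using h1
    refine ⟨k, -((q.coeff 0)⁻¹ • Polynomial.aeval M q.divX), (hcm.smul_right _).neg_right, ?_⟩
    rw [← Polynomial.X_mul_divX_add q] at h0
    simp only [map_add, map_mul, Polynomial.aeval_X, Polynomial.aeval_C, mul_add,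
      Algebra.algebraMap_eq_smul_one, mul_smul_comm, mul_one] at h0
    rw [← mul_assoc, ← pow_succ] at h0
    rw [mul_neg, mul_smul_comm, eq_neg_of_add_eq_zero_left h0, smul_neg, neg_neg,
      smul_smul, inv_mul_cancel₀ hc, one_smul]
  obtain ⟨k, s, hs, hk⟩ := key
  have hj : ∀ j : ℕ, M ^ k = M ^ (k + j) * s ^ j := by
    intro j
    induction j with
    | zero => simp
    | succ j ih =>
      calc M ^ k = M ^ (k + j) * s ^ j := ih
        _ = M ^ j * M ^ k * s ^ j := by rw [← pow_add, add_comm j k]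
        _ = M ^ j * (M ^ (k + 1) * s) * s ^ j := by rw [← hk]
        _ = (M ^ j * M ^ (k + 1)) * (s * s ^ j) := by simp only [mul_assoc]
        _ = M ^ (k + (j + 1)) * s ^ (j + 1) := by
          rw [← pow_add, ← pow_succ', show j + (k + 1) = k + (j + 1) by ring]
  have hj' : M ^ k = M ^ (2 * k + 1) * s ^ (k + 1) := by
    have := hj (k + 1)
    rwa [show k + (k + 1) = 2 * k + 1 by ring] at this
  have hXM : M ^ k * s ^ (k + 1) * M ^ (k + 1) = M ^ k := by
    rw [mul_assoc, ((hs.pow_pow (k + 1) (k + 1)).eq).symm, ← mul_assoc, ← pow_add,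
      show k + (k + 1) = 2 * k + 1 by ring, ← hj']
  refine ⟨M ^ k * s ^ (k + 1), ⟨?_, ?_, ⟨k, hXM⟩⟩, ?_⟩
  · exact (((Commute.refl M).pow_right k).mul_right (hs.pow_right (k + 1))).eq.symm
  · calc M ^ k * s ^ (k + 1) * M * (M ^ k * s ^ (k + 1))
        = (M ^ k * s ^ (k + 1) * M ^ (k + 1)) * s ^ (k + 1) := by
          rw [pow_succ' M k]; simp only [mul_assoc]
      _ = M ^ k * s ^ (k + 1) := by rw [hXM]
  · have uniq : ∀ X Y : Matrix ι ι K, IsDrazinInverse M X → IsDrazinInverse M Y → X = Y := by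
      intro X Y hX hY
      obtain ⟨a, ha⟩ := hX.index
      obtain ⟨b, hb⟩ := hY.index
      have up : ∀ (Z : Matrix ι ι K) (c d : ℕ), Z * M ^ (c + 1) = M ^ c →
          Z * M ^ (c + d + 1) = M ^ (c + d) := by
        intro Z c d h
        rw [show c + d + 1 = c + 1 + d by ring, pow_add, ← mul_assoc, h, ← pow_add]
      have ha' := up X a b ha
      have hb' := up Y b a hb
      rw [add_comm b a] at hb'
      set l := a + b
      have expand : ∀ Z : Matrix ι ι K, IsDrazinInverse M Z → ∀ j : ℕ,
          Z = Z ^ (j + 1) * M ^ j := by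
        intro Z hZ j
        induction j with
        | zero => simp
        | succ j ih =>
          have hc : Commute Z M := hZ.comm
          calc Z = Z * M * Z := hZ.outer.symm
            _ = Z * M * (Z ^ (j + 1) * M ^ j) := by rw [← ih]
            _ = Z * (M * Z ^ (j + 1)) * M ^ j := by simp only [mul_assoc]
            _ = Z * (Z ^ (j + 1) * M) * M ^ j := by rw [(hc.pow_left (j + 1)).eq]
            _ = (Z * Z ^ (j + 1)) * (M * M ^ j) := by simp only [mul_assoc]
            _ = Z ^ (j + 1 + 1) * M ^ (j + 1) := by rw [← pow_succ', ← pow_succ']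
      have cX : Commute X M := hX.comm
      have cY : Commute Y M := hY.comm
      have e1 : X = X * M * Y := by
        calc X = X ^ (l + 1) * M ^ l := expand X hX l
          _ = X ^ (l + 1) * (Y * M ^ (l + 1)) := by rw [hb']
          _ = X ^ (l + 1) * (M ^ l * M * Y) := by rw [(cY.pow_right (l + 1)).eq, pow_succ M l]
          _ = (X ^ (l + 1) * M ^ l) * M * Y := by simp only [mul_assoc]
          _ = X * M * Y := by rw [← expand X hX l]
      have e2 : Y = X * M * Y := by
        calc Y = Y ^ (l + 1) * M ^ l := expand Y hY l
          _ = M ^ l * Y ^ (l + 1) := (cY.pow_pow (l + 1) l).eq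
          _ = X * M ^ (l + 1) * Y ^ (l + 1) := by rw [ha']
          _ = X * M * (M ^ l * Y ^ (l + 1)) := by rw [pow_succ' M l]; simp only [mul_assoc]
          _ = X * M * (Y ^ (l + 1) * M ^ l) := by rw [(cY.pow_pow (l + 1) l).eq]
          _ = X * M * Y := by rw [← expand Y hY l]
      exact e1.trans e2.symm
    intro Y hY
    exact uniq _ _ hY ⟨(((Commute.refl M).pow_right k).mul_right (hs.pow_right (k + 1))).eq.symm,
      by
        calc M ^ k * s ^ (k + 1) * M * (M ^ k * s ^ (k + 1))
            = (M ^ k * s ^ (k + 1) * M ^ (k + 1)) * s ^ (k + 1) := by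
              rw [pow_succ' M k]; simp only [mul_assoc]
          _ = M ^ k * s ^ (k + 1) := by rw [hXM], ⟨k, hXM⟩⟩

/-- The Drazin inverse `M^D` of a square matrix. -/
def drazinInverse {K ι : Type*} [Field K] [Fintype ι] [DecidableEq ι]
    (M : Matrix ι ι K) : Matrix ι ι K :=
  (existsUnique_isDrazinInverse M).choose

theorem drazinInverse_spec {K ι : Type*} [Field K] [Fintype ι] [DecidableEq ι]
    (M : Matrix ι ι K) : IsDrazinInverse M (drazinInverse M) :=
  (existsUnique_isDrazinInverse M).choose_spec.1

/-- The set `Σ_{n,m}` of port-Hamiltonian systems `(J, R, Q, B)`: `J` is skew-Hermitian, `R` and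
`Q` are Hermitian positive semidefinite, `B` is arbitrary. -/
def portHamiltonianSystems (𝕜 : Type*) [RCLike 𝕜] (n m : ℕ) :
    Set (Matrix (Fin n) (Fin n) 𝕜 × Matrix (Fin n) (Fin n) 𝕜 × Matrix (Fin n) (Fin n) 𝕜 ×
      Matrix (Fin n) (Fin m) 𝕜) :=
  {p | p.1 = -(p.1)ᴴ ∧ p.2.1.PosSemidef ∧ p.2.2.1.PosSemidef}

section Pencil

variable {𝕜 : Type*} [RCLike 𝕜] {n m : ℕ}

/-- The matrix `ℰ = [[0, I, 0], [-I, 0, 0], [0, 0, 0]]`, with blocks of sizes `n, n, m`. -/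
def pencilE (𝕜 : Type*) [RCLike 𝕜] (n m : ℕ) :
    Matrix ((Fin n ⊕ Fin n) ⊕ Fin m) ((Fin n ⊕ Fin n) ⊕ Fin m) 𝕜 :=
  Matrix.fromBlocks (Matrix.fromBlocks 0 1 (-1) 0) 0 0 0

/-- The matrix `𝒜_S = [[0, (J-R)Q, B], [((J-R)Q)ᴴ, QRQ, 0], [Bᴴ, 0, S]]`. -/
def pencilA (J R Q : Matrix (Fin n) (Fin n) 𝕜) (B : Matrix (Fin n) (Fin m) 𝕜)
    (S : Matrix (Fin m) (Fin m) 𝕜) :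
    Matrix ((Fin n ⊕ Fin n) ⊕ Fin m) ((Fin n ⊕ Fin n) ⊕ Fin m) 𝕜 :=
  Matrix.fromBlocks
    (Matrix.fromBlocks 0 ((J - R) * Q) ((J - R) * Q)ᴴ (Q * R * Q)) (Matrix.fromRows B 0)
    (Matrix.fromCols Bᴴ 0) S

/-- `E_μ = [[0, (J-R)Q - μI], [((J-R)Q)ᴴ + μI, QRQ]]⁻¹`. -/
def Emu (J R Q : Matrix (Fin n) (Fin n) 𝕜) (μ : 𝕜) :
    Matrix (Fin n ⊕ Fin n) (Fin n ⊕ Fin n) 𝕜 :=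
  (Matrix.fromBlocks 0 ((J - R) * Q - μ • 1) (((J - R) * Q)ᴴ + μ • 1) (Q * R * Q))⁻¹

/-- `S_μ = S - [Bᴴ 0] E_μ [B; 0]`. -/
def Smu (J R Q : Matrix (Fin n) (Fin n) 𝕜) (B : Matrix (Fin n) (Fin m) 𝕜)
    (S : Matrix (Fin m) (Fin m) 𝕜) (μ : 𝕜) : Matrix (Fin m) (Fin m) 𝕜 :=
  S - Matrix.fromCols Bᴴ (0 : Matrix (Fin m) (Fin n) 𝕜) * Emu J R Q μ *
    Matrix.fromRows B (0 : Matrix (Fin n) (Fin m) 𝕜)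

/-- `N_μ = (E_μ + E_μ [B; 0] S_μ⁻¹ [Bᴴ 0] E_μ) [[0, -I], [I, 0]]`. -/
def Nmu (J R Q : Matrix (Fin n) (Fin n) 𝕜) (B : Matrix (Fin n) (Fin m) 𝕜)
    (S : Matrix (Fin m) (Fin m) 𝕜) (μ : 𝕜) : Matrix (Fin n ⊕ Fin n) (Fin n ⊕ Fin n) 𝕜 :=
  (Emu J R Q μ +
    Emu J R Q μ * Matrix.fromRows B (0 : Matrix (Fin n) (Fin m) 𝕜) * (Smu J R Q B S μ)⁻¹ *
      Matrix.fromCols Bᴴ (0 : Matrix (Fin m) (Fin n) 𝕜) * Emu J R Q μ) *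
    Matrix.fromBlocks 0 (-1) 1 0

/-- `exp(-[N_μ^D (I - μ N_μ)] s)`. -/
def flowMatrix (J R Q : Matrix (Fin n) (Fin n) 𝕜) (B : Matrix (Fin n) (Fin m) 𝕜)
    (S : Matrix (Fin m) (Fin m) 𝕜) (μ : 𝕜) (s : ℝ) :
    Matrix (Fin n ⊕ Fin n) (Fin n ⊕ Fin n) 𝕜 :=
  NormedSpace.exp
    ((s : 𝕜) • (-(drazinInverse (Nmu J R Q B S μ) * (1 - μ • Nmu J R Q B S μ))))

/-- `f ∈ 𝒞¹([a, b], F)`: on `[a, b]`, `f` coincides with a function that is continuously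
differentiable on a larger open interval. -/
def IsC1OnIcc {F : Type*} [NormedAddCommGroup F] [NormedSpace ℝ F] (f : ℝ → F) (a b : ℝ) :
    Prop :=
  ∃ ε > 0, ∃ g : ℝ → F, ContDiffOn ℝ 1 g (Set.Ioo (a - ε) (b + ε)) ∧
    Set.EqOn f g (Set.Icc a b)

/-- `(lam, x, u)` is a `𝒞¹` solution on `[t₀, t₁]` of the optimality DAE
`d/dt ℰ (lam, x, u) = 𝒜_S (lam, x, u)`. -/
structure IsOptimalityDAESolution (J R Q : Matrix (Fin n) (Fin n) 𝕜)
    (B : Matrix (Fin n) (Fin m) 𝕜) (S : Matrix (Fin m) (Fin m) 𝕜) (t₀ t₁ : ℝ)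
    (lam x : ℝ → Fin n → 𝕜) (u : ℝ → Fin m → 𝕜) : Prop where
  contDiff : IsC1OnIcc (fun t => Sum.elim (Sum.elim (lam t) (x t)) (u t)) t₀ t₁
  dae : ∀ t ∈ Set.Icc t₀ t₁,
    pencilE 𝕜 n m *ᵥ
        derivWithin (fun t => Sum.elim (Sum.elim (lam t) (x t)) (u t)) (Set.Icc t₀ t₁) t =
      pencilA J R Q B S *ᵥ Sum.elim (Sum.elim (lam t) (x t)) (u t)

end Pencil

end

/-! Write `y = (λ, x)` and shift the pencil by `μ`. The leading `2n × 2n` block `G` of `𝒜_S - μℰ` is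
invertible by the choice of `μ`, and regularity at `μ` makes its Schur complement `S_μ` invertible.
Eliminating `u` turns the DAE into `y = N (μ y - y')` with `N = N_μ`, and `u` becomes a fixed matrix
applied to `μ y - y'` (`pencil_dae_iff`).

Let `D` be the Drazin inverse and `P = D N`, a projection commuting with `N`. On `ker P` the matrix
`N` is nilpotent, so solutions stay in `im P`. There `D` inverts `N`, and the equation becomes `y' =
-D (1 - μ N) y`. Thus the solutions `y` are exactly the exponential orbits starting in `im P`. The
second block row at `t₁` reads `x(t₁) = E₃ λ(t₀) + E₄ x(t₀)`, so invertibility of `E₃` forces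
`λ(t₀)`. What remains is that this initial vector lie in `im P`. -/

/-! ### Block matrices and Schur complements. -/

theorem spectrum_notMem_sub_isUnit {K ι : Type*} [Field K] [Fintype ι] [DecidableEq ι]
    {M : Matrix ι ι K} {μ : K} (h : μ ∉ spectrum K M) : IsUnit (M - μ • 1) := by
  rw [spectrum.notMem_iff, Algebra.algebraMap_eq_smul_one] at h
  simpa using h.neg

theorem isUnit_fromBlocks_zero₁₁ {K ι : Type*} [Field K] [Fintype ι] [DecidableEq ι]
    {X Y : Matrix ι ι K} (Z : Matrix ι ι K) (hX : IsUnit X) (hY : IsUnit Y) :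
    IsUnit (Matrix.fromBlocks 0 X Y Z) := by
  rw [Matrix.isUnit_iff_isUnit_det] at hX hY
  refine IsUnit.of_mul_eq_one (Matrix.fromBlocks (-(Y⁻¹ * Z * X⁻¹)) Y⁻¹ X⁻¹ 0) ?_
  rw [Matrix.fromBlocks_multiply, ← Matrix.fromBlocks_one]
  congr 1
  · simp [Matrix.mul_nonsing_inv _ hX]
  · simp
  · simp [Matrix.mul_assoc, Matrix.mul_nonsing_inv_cancel_left _ _ hY]
  · simp [Matrix.mul_nonsing_inv _ hY]

/-- Block elimination in `G y + b u = f`, `c y + S u = 0`. -/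
theorem block_elimination {K ι κ : Type*} [Field K] [Fintype ι] [DecidableEq ι]
    [Fintype κ] [DecidableEq κ] {G : Matrix ι ι K} (b : Matrix ι κ K) (c : Matrix κ ι K)
    (S : Matrix κ κ K) (hG : IsUnit G) (hS : IsUnit (S - c * G⁻¹ * b))
    (y f : ι → K) (u : κ → K) :
    (G *ᵥ y + b *ᵥ u = f ∧ c *ᵥ y + S *ᵥ u = 0) ↔
      (y = (G⁻¹ + G⁻¹ * b * (S - c * G⁻¹ * b)⁻¹ * c * G⁻¹) *ᵥ f ∧
        u = -((S - c * G⁻¹ * b)⁻¹ * c * G⁻¹) *ᵥ f) := by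
  have hG' := (Matrix.isUnit_iff_isUnit_det _).1 hG
  have hS' := (Matrix.isUnit_iff_isUnit_det _).1 hS
  constructor
  · rintro ⟨h1, h2⟩
    have hy : y = G⁻¹ *ᵥ f - (G⁻¹ * b) *ᵥ u := by
      rw [← h1, Matrix.mulVec_add, Matrix.mulVec_mulVec, Matrix.mulVec_mulVec,
        Matrix.nonsing_inv_mul _ hG', Matrix.one_mulVec, add_sub_cancel_right]
    have hu : (S - c * G⁻¹ * b) *ᵥ u = -((c * G⁻¹) *ᵥ f) := by
      rw [hy] at h2
      simp only [Matrix.mulVec_sub, Matrix.mulVec_mulVec, Matrix.sub_mulVec,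
        ← Matrix.mul_assoc] at h2 ⊢
      rw [eq_neg_iff_add_eq_zero, ← h2]
      abel
    have hu' : u = -((S - c * G⁻¹ * b)⁻¹ * c * G⁻¹) *ᵥ f := by
      rw [← Matrix.one_mulVec u, ← Matrix.nonsing_inv_mul _ hS', ← Matrix.mulVec_mulVec, hu]
      simp only [Matrix.mulVec_neg, Matrix.neg_mulVec, Matrix.mulVec_mulVec, ← Matrix.mul_assoc]
    refine ⟨?_, hu'⟩
    rw [hy, hu']
    simp only [Matrix.mulVec_neg, Matrix.neg_mulVec, Matrix.mulVec_mulVec, ← Matrix.mul_assoc,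
      Matrix.add_mulVec, sub_neg_eq_add]
  · rintro ⟨hy, hu⟩
    have hy' : y = G⁻¹ *ᵥ f - (G⁻¹ * b) *ᵥ u := by
      rw [hy, hu]
      simp only [Matrix.mulVec_neg, Matrix.neg_mulVec, Matrix.mulVec_mulVec, ← Matrix.mul_assoc,
        Matrix.add_mulVec, sub_neg_eq_add]
    constructor
    · rw [hy', Matrix.mulVec_sub, Matrix.mulVec_mulVec, Matrix.mulVec_mulVec, ← Matrix.mul_assoc,
        Matrix.mul_nonsing_inv _ hG', Matrix.one_mulVec, Matrix.one_mul, sub_add_cancel]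
    · have hu' : (S - c * G⁻¹ * b) *ᵥ u = -((c * G⁻¹) *ᵥ f) := by
        rw [hu, Matrix.mulVec_mulVec, Matrix.mul_neg, Matrix.mul_assoc _ c,
          Matrix.mul_nonsing_inv_cancel_left _ _ hS', Matrix.neg_mulVec]
      rw [eq_neg_iff_add_eq_zero] at hu'
      rw [← hu', hy']
      simp only [Matrix.mulVec_sub, Matrix.mulVec_mulVec, Matrix.sub_mulVec, ← Matrix.mul_assoc]
      abel

/-! ### Matrix exponentials and linear systems on an interval. -/

section Calculus

variable {𝕜 : Type*} [RCLike 𝕜] {ι : Type*} [Fintype ι]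

theorem HasDerivWithinAt.matrix_mulVec {κ : Type*} {A : ℝ → Matrix κ ι 𝕜} {A' : Matrix κ ι 𝕜}
    {y : ℝ → ι → 𝕜} {y' : ι → 𝕜} {s : Set ℝ} {t : ℝ} [Finite κ]
    (hA : ∀ i j, HasDerivWithinAt (fun τ => A τ i j) (A' i j) s t)
    (hy : HasDerivWithinAt y y' s t) :
    HasDerivWithinAt (fun τ => A τ *ᵥ y τ) (A' *ᵥ y t + A t *ᵥ y') s t := by
  have := Fintype.ofFinite κ
  rw [hasDerivWithinAt_pi] at hy ⊢
  intro i
  simp only [Matrix.mulVec, dotProduct, Pi.add_apply, ← Finset.sum_add_distrib]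
  exact HasDerivWithinAt.fun_sum fun j _ => (hA i j).mul (hy j)

theorem HasDerivWithinAt.const_matrix_mulVec {κ : Type*} (A : Matrix κ ι 𝕜)
    {y : ℝ → ι → 𝕜} {y' : ι → 𝕜} {s : Set ℝ} {t : ℝ} [Finite κ]
    (hy : HasDerivWithinAt y y' s t) :
    HasDerivWithinAt (fun τ => A *ᵥ y τ) (A *ᵥ y') s t := by
  simpa using HasDerivWithinAt.matrix_mulVec (A := fun _ => A) (A' := 0)
    (fun i j => by simpa using hasDerivWithinAt_const t s (A i j)) hy

variable [DecidableEq ι]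

open scoped Matrix.Norms.Operator in
-- The entrywise form keeps any choice of matrix norm out of the statement; the operator norm serves
-- only inside the proof.
theorem hasDerivAt_matrix_exp_smul_apply (M : Matrix ι ι 𝕜) (t : ℝ) (i j : ι) :
    HasDerivAt (fun τ : ℝ => NormedSpace.exp ((τ : 𝕜) • M) i j)
      ((NormedSpace.exp ((t : 𝕜) • M) * M) i j) t := by
  have h := hasDerivAt_exp_smul_const (𝕂 := ℝ) M t
  have h2 := ((Matrix.entryLinearMap ℝ 𝕜 i j).toContinuousLinearMap.hasFDerivAt
    (x := NormedSpace.exp (t • M))).comp_hasDerivAt t h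
  have e : ∀ τ : ℝ, (τ : 𝕜) • M = τ • M := fun τ => (RCLike.real_smul_eq_coe_smul τ M).symm
  simp only [e]
  exact h2

theorem matrix_exp_smul_neg_mul_cancel (M : Matrix ι ι 𝕜) (t : 𝕜) :
    NormedSpace.exp (t • M) * NormedSpace.exp ((-t) • M) = 1 := by
  rw [← Matrix.exp_add_of_commute _ _ (by simp), ← add_smul, add_neg_cancel, zero_smul,
    NormedSpace.exp_zero]

theorem hasDerivAt_matrix_exp_smul_mulVec (M : Matrix ι ι 𝕜) (v : ι → 𝕜) (t₀ t : ℝ) :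
    HasDerivAt (fun τ : ℝ => NormedSpace.exp (((τ - t₀ : ℝ) : 𝕜) • M) *ᵥ v)
      (M *ᵥ (NormedSpace.exp (((t - t₀ : ℝ) : 𝕜) • M) *ᵥ v)) t := by
  have hc : M * NormedSpace.exp (((t - t₀ : ℝ) : 𝕜) • M)
      = NormedSpace.exp (((t - t₀ : ℝ) : 𝕜) • M) * M := by
    open scoped Matrix.Norms.Operator in
    exact ((Commute.refl M).smul_right _).exp_right.eq
  rw [Matrix.mulVec_mulVec, hc, ← hasDerivWithinAt_univ]
  simpa using HasDerivWithinAt.matrix_mulVec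
    (A := fun τ : ℝ => NormedSpace.exp (((τ - t₀ : ℝ) : 𝕜) • M))
    (fun i j => ((hasDerivAt_matrix_exp_smul_apply M (t - t₀) i j).comp_sub_const t t₀
      ).hasDerivWithinAt) (hasDerivWithinAt_const t Set.univ v)

theorem contDiff_matrix_exp_smul_mulVec (M : Matrix ι ι 𝕜) (v : ι → 𝕜) (t₀ : ℝ) :
    ContDiff ℝ 1 (fun τ : ℝ => NormedSpace.exp (((τ - t₀ : ℝ) : 𝕜) • M) *ᵥ v) := by
  have h := hasDerivAt_matrix_exp_smul_mulVec M v t₀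
  have hd : Differentiable ℝ
      (fun τ : ℝ => NormedSpace.exp (((τ - t₀ : ℝ) : 𝕜) • M) *ᵥ v) :=
    fun t => (h t).differentiableAt
  rw [contDiff_one_iff_deriv]
  refine ⟨hd, ?_⟩
  rw [show deriv _ = _ from funext fun t => (h t).deriv]
  exact continuous_const.matrix_mulVec hd.continuous

/-- A linear homogeneous system `y' = M y` on `[a, b]` is solved by the matrix exponential only. -/
theorem eq_matrix_exp_smul_mulVec_of_hasDerivWithinAt {M : Matrix ι ι 𝕜} {y : ℝ → ι → 𝕜} {a b : ℝ}
    (hy : ∀ t ∈ Set.Icc a b, HasDerivWithinAt y (M *ᵥ y t) (Set.Icc a b) t)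
    {t : ℝ} (ht : t ∈ Set.Icc a b) :
    y t = NormedSpace.exp (((t - a : ℝ) : 𝕜) • M) *ᵥ y a := by
  -- Undo the flow: `p` has zero derivative, hence equals `p a = y a`.
  set p : ℝ → ι → 𝕜 := fun τ => NormedSpace.exp (((τ - a : ℝ) : 𝕜) • (-M)) *ᵥ y τ with hp
  have hd : ∀ τ ∈ Set.Icc a b, HasDerivWithinAt p 0 (Set.Icc a b) τ := by
    intro τ hτ
    have := HasDerivWithinAt.matrix_mulVec
      (A := fun τ : ℝ => NormedSpace.exp (((τ - a : ℝ) : 𝕜) • (-M)))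
      (fun i j => ((hasDerivAt_matrix_exp_smul_apply (-M) (τ - a) i j).comp_sub_const τ a
      ).hasDerivWithinAt) (hy τ hτ)
    convert this using 1
    rw [Matrix.mul_neg, Matrix.neg_mulVec, Matrix.mulVec_mulVec, neg_add_cancel]
  have hc := constant_of_derivWithin_zero (fun τ hτ => (hd τ hτ).differentiableWithinAt)
    (fun τ hτ => (hd τ (Set.Ico_subset_Icc_self hτ)).derivWithin
      (uniqueDiffOn_Icc (hτ.1.trans_lt hτ.2) τ (Set.Ico_subset_Icc_self hτ))) t ht
  have hpa : p a = y a := by simp [hp]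
  rw [hpa] at hc
  have := matrix_exp_smul_neg_mul_cancel M ((t - a : ℝ) : 𝕜)
  rw [← hc, hp, Matrix.mulVec_mulVec, smul_neg, ← neg_smul, this, Matrix.one_mulVec]

theorem IsC1OnIcc.hasDerivWithinAt {F : Type*} [NormedAddCommGroup F] [NormedSpace ℝ F]
    {f : ℝ → F} {a b : ℝ} (hf : IsC1OnIcc f a b) {t : ℝ} (ht : t ∈ Set.Icc a b) :
    HasDerivWithinAt f (derivWithin f (Set.Icc a b) t) (Set.Icc a b) t := by
  obtain ⟨ε, hε, g, hg, hfg⟩ := hf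
  have hmem : t ∈ Set.Ioo (a - ε) (b + ε) := ⟨by linarith [ht.1], by linarith [ht.2]⟩
  have h := ((hg.differentiableOn one_ne_zero).differentiableAt (isOpen_Ioo.mem_nhds hmem)
    ).differentiableWithinAt (s := Set.Icc a b)
  exact (h.congr hfg (hfg ht)).hasDerivWithinAt

theorem ContDiff.isC1OnIcc {F : Type*} [NormedAddCommGroup F] [NormedSpace ℝ F]
    {f : ℝ → F} (hf : ContDiff ℝ 1 f) (a b : ℝ) : IsC1OnIcc f a b :=
  ⟨1, one_pos, f, hf.contDiffOn, fun _ _ => rfl⟩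

end Calculus

/-! ### The equation `y = N (μ y - y')` and the Drazin projection. -/

section Drazin

variable {𝕜 : Type*} [RCLike 𝕜] {ι : Type*} [Fintype ι] [DecidableEq ι] {N D : Matrix ι ι 𝕜}

theorem IsDrazinInverse.isIdempotentElem (h : IsDrazinInverse N D) : D * N * (D * N) = D * N := by
  rw [← mul_assoc, h.outer]

theorem IsDrazinInverse.commute_proj (h : IsDrazinInverse N D) : Commute (D * N) N :=
  Commute.mul_left h.comm (Commute.refl N)

/-- Solutions of `y = N (μ y - y')` take values in the image of the spectral projection. -/
theorem IsDrazinInverse.proj_mulVec_eq_of_dae (h : IsDrazinInverse N D) {μ : 𝕜}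
    {y y' : ℝ → ι → 𝕜} {a b : ℝ} (hab : a < b)
    (hy : ∀ t ∈ Set.Icc a b, HasDerivWithinAt y (y' t) (Set.Icc a b) t)
    (hdae : ∀ t ∈ Set.Icc a b, y t = N *ᵥ (μ • y t - y' t)) {t : ℝ} (ht : t ∈ Set.Icc a b) :
    (D * N) *ᵥ y t = y t := by
  have hc : Commute (1 - D * N) N := (Commute.one_left N).sub_left h.commute_proj
  obtain ⟨ν, hν⟩ := h.index
  have h0 : (1 - D * N) * N ^ ν = 0 := by
    rw [sub_mul, one_mul, mul_assoc, ← pow_succ', hν, sub_self]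
  -- Lower the exponent from `ν` to `0`. If `(1 - P) N ^ (j + 1)` kills `y` on the whole interval,
  -- it also kills `y'`, so applying `(1 - P) N ^ j` to `y = N (μ y - y')` gives zero. Only first
  -- derivatives of `y` are needed.
  have key : ∀ k ≤ ν, ∀ τ ∈ Set.Icc a b, ((1 - D * N) * N ^ (ν - k)) *ᵥ y τ = 0 := by
    intro k
    induction k with
    | zero => intro _ τ _; rw [Nat.sub_zero, h0, Matrix.zero_mulVec]
    | succ k ih =>
      intro hk τ hτ
      have ih' := ih (by omega)
      have e : ν - k = ν - (k + 1) + 1 := by omega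
      have hd := HasDerivWithinAt.const_matrix_mulVec ((1 - D * N) * N ^ (ν - k)) (hy τ hτ)
      have hd0 : HasDerivWithinAt (fun s => ((1 - D * N) * N ^ (ν - k)) *ᵥ y s) 0
          (Set.Icc a b) τ :=
        (hasDerivWithinAt_const τ _ (0 : ι → 𝕜)).congr ih' (ih' τ hτ)
      have hz := (uniqueDiffOn_Icc hab τ hτ).eq_deriv _ hd hd0
      rw [hdae τ hτ, Matrix.mulVec_mulVec, mul_assoc, ← pow_succ, ← e, Matrix.mulVec_sub,
        Matrix.mulVec_smul, ih' τ hτ, hz, smul_zero, sub_zero]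
  have := key ν le_rfl t ht
  rw [Nat.sub_self, pow_zero, mul_one, Matrix.sub_mulVec, Matrix.one_mulVec, sub_eq_zero] at this
  exact this.symm

/-- Since `P` fixes `y` and hence `y'`, applying `D` to the equation gives `D y = μ y - y'`, an
explicit ODE. -/
theorem IsDrazinInverse.eq_of_dae (h : IsDrazinInverse N D) {μ : 𝕜}
    {y y' : ℝ → ι → 𝕜} {a b : ℝ} (hab : a < b)
    (hy : ∀ t ∈ Set.Icc a b, HasDerivWithinAt y (y' t) (Set.Icc a b) t)
    (hdae : ∀ t ∈ Set.Icc a b, y t = N *ᵥ (μ • y t - y' t)) {t : ℝ} (ht : t ∈ Set.Icc a b) :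
    y t = NormedSpace.exp (((t - a : ℝ) : 𝕜) • (-(D * (1 - μ • N)))) *ᵥ y a := by
  refine eq_matrix_exp_smul_mulVec_of_hasDerivWithinAt (fun τ hτ => ?_) ht
  have hproj := fun s hs => h.proj_mulVec_eq_of_dae hab hy hdae (t := s) hs
  have hproj' : (D * N) *ᵥ y' τ = y' τ :=
    (uniqueDiffOn_Icc hab τ hτ).eq_deriv _ (HasDerivWithinAt.const_matrix_mulVec (D * N) (hy τ hτ))
      ((hy τ hτ).congr hproj (hproj τ hτ))
  convert hy τ hτ using 1
  have h1 : D *ᵥ y τ = μ • y τ - y' τ := by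
    conv_lhs => rw [hdae τ hτ]
    rw [Matrix.mulVec_mulVec, Matrix.mulVec_sub, Matrix.mulVec_smul, hproj τ hτ, hproj']
  rw [mul_sub, mul_one, mul_smul_comm, Matrix.neg_mulVec, Matrix.sub_mulVec, Matrix.smul_mulVec,
    hproj τ hτ, h1]
  abel

/-- Converse direction: `P` commutes with the generator, so the orbit of `v` stays in `im P`, where
`N D` acts as the identity. -/
theorem IsDrazinInverse.exp_mulVec_dae (h : IsDrazinInverse N D) (μ s : 𝕜) {v : ι → 𝕜}
    (hv : (D * N) *ᵥ v = v) :
    let y := NormedSpace.exp (s • (-(D * (1 - μ • N)))) *ᵥ v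
    y = N *ᵥ (μ • y - (-(D * (1 - μ • N))) *ᵥ y) := by
  have hc : Commute (D * N) (-(D * (1 - μ • N))) := by
    have hD : Commute (D * N) D := (Commute.refl D).mul_left h.comm.symm
    exact (hD.mul_right ((Commute.one_right _).sub_right (h.commute_proj.smul_right μ))).neg_right
  have he : Commute (D * N) (NormedSpace.exp (s • (-(D * (1 - μ • N))))) := by
    open scoped Matrix.Norms.Operator in
    exact (hc.smul_right s).exp_right
  set X := NormedSpace.exp (s • (-(D * (1 - μ • N))))
  have hy : (D * N) *ᵥ (X *ᵥ v) = X *ᵥ v := by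
    rw [Matrix.mulVec_mulVec, he.eq, ← Matrix.mulVec_mulVec, hv]
  have hND : N * D = D * N := h.comm.symm
  change X *ᵥ v = N *ᵥ (μ • X *ᵥ v - (-(D * (1 - μ • N))) *ᵥ X *ᵥ v)
  rw [Matrix.neg_mulVec, sub_neg_eq_add, Matrix.mulVec_add, Matrix.mulVec_mulVec _ N, ← mul_assoc,
    hND, mul_sub, mul_one, mul_smul_comm, Matrix.sub_mulVec, hy, h.commute_proj.eq,
    Matrix.smul_mulVec, ← Matrix.mulVec_mulVec, hy, Matrix.mulVec_smul]
  abel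

end Drazin

/-! ### Elimination of the control. -/

section Pencil

variable {𝕜 : Type*} [RCLike 𝕜] {n m : ℕ}

theorem pencil_dae_iff (J R Q : Matrix (Fin n) (Fin n) 𝕜) (B : Matrix (Fin n) (Fin m) 𝕜)
    (S : Matrix (Fin m) (Fin m) 𝕜) (μ : 𝕜)
    (hμ : μ ∉ spectrum 𝕜 ((J - R) * Q) ∪ spectrum 𝕜 (-((J - R) * Q)ᴴ))
    (hreg : IsUnit (μ • pencilE 𝕜 n m - pencilA J R Q B S))
    (y y' : Fin n ⊕ Fin n → 𝕜) (u u' : Fin m → 𝕜) :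
    pencilE 𝕜 n m *ᵥ Sum.elim y' u' = pencilA J R Q B S *ᵥ Sum.elim y u ↔
      (y = Nmu J R Q B S μ *ᵥ (μ • y - y') ∧
        u = ((Smu J R Q B S μ)⁻¹ * Matrix.fromCols Bᴴ (0 : Matrix (Fin m) (Fin n) 𝕜) *
          Emu J R Q μ * (Matrix.fromBlocks 0 1 (-1) 0 :
            Matrix (Fin n ⊕ Fin n) (Fin n ⊕ Fin n) 𝕜)) *ᵥ (μ • y - y')) := by
  rw [Set.mem_union, not_or] at hμ
  have hX := spectrum_notMem_sub_isUnit hμ.1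
  have hY : IsUnit (((J - R) * Q)ᴴ + μ • 1) := by
    simpa [add_comm] using (spectrum_notMem_sub_isUnit hμ.2).neg
  have hG := isUnit_fromBlocks_zero₁₁ (Q * R * Q) hX hY
  set G := Matrix.fromBlocks 0 ((J - R) * Q - μ • 1) (((J - R) * Q)ᴴ + μ • 1) (Q * R * Q) with hGdef
  set b := Matrix.fromRows B (0 : Matrix (Fin n) (Fin m) 𝕜) with hb
  set c := Matrix.fromCols Bᴴ (0 : Matrix (Fin m) (Fin n) 𝕜) with hc
  set F : Matrix (Fin n ⊕ Fin n) (Fin n ⊕ Fin n) 𝕜 := Matrix.fromBlocks 0 1 (-1) 0 with hF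
  have hE : Emu J R Q μ = G⁻¹ := rfl
  have hSm : Smu J R Q B S μ = S - c * G⁻¹ * b := rfl
  have hGF : Matrix.fromBlocks 0 ((J - R) * Q) ((J - R) * Q)ᴴ (Q * R * Q) = G + μ • F := by
    rw [hGdef, hF, Matrix.fromBlocks_smul, Matrix.fromBlocks_add]
    simp
  have hA : pencilA J R Q B S = Matrix.fromBlocks (G + μ • F) b c S := by rw [← hGF]; rfl
  have hEp : pencilE 𝕜 n m = Matrix.fromBlocks F 0 0 0 := rfl
  -- This is the Schur complement of `G` in `𝒜_S - μℰ`, the negative of the matrix in `hreg`.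
  have hS' : IsUnit (S - c * G⁻¹ * b) := by
    let := hG.invertible
    rw [← Matrix.invOf_eq_nonsing_inv, ← Matrix.isUnit_fromBlocks_iff_of_invertible₁₁]
    convert hreg.neg using 1
    rw [hA, hEp, Matrix.fromBlocks_smul, sub_eq_add_neg, Matrix.fromBlocks_neg,
      Matrix.fromBlocks_add, Matrix.fromBlocks_neg]
    simp
  -- The right factor in `N_μ` is `-F`; this sign is why `μ y - y'` appears while the elimination
  -- has right-hand side `F (y' - μ y)`.
  have hN : Nmu J R Q B S μ = -((G⁻¹ + G⁻¹ * b * (S - c * G⁻¹ * b)⁻¹ * c * G⁻¹) * F) := by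
    rw [← Matrix.mul_neg, hF, Matrix.fromBlocks_neg]
    simp [Nmu, hE, hSm, hb, hc]
  clear_value F b c G
  have key := block_elimination b c S hG hS' y (F *ᵥ (y' - μ • y)) u
  rw [hEp, hA, Matrix.fromBlocks_mulVec, Matrix.fromBlocks_mulVec, hN, hSm, hE]
  have e : μ • y - y' = -(y' - μ • y) := by abel
  rw [e, Matrix.neg_mulVec, Matrix.mulVec_neg, neg_neg, Matrix.mulVec_neg]
  simp only [← Matrix.mulVec_mulVec _ _ F, ← Matrix.neg_mulVec]
  rw [← key, Sum.elim_eq_iff]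
  simp only [Function.comp_def, Sum.elim_inl, Sum.elim_inr, Matrix.zero_mulVec, add_zero,
    Matrix.mulVec_sub, Matrix.mulVec_smul, Matrix.add_mulVec, Matrix.smul_mulVec]
  refine and_congr ?_ eq_comm
  rw [eq_sub_iff_add_eq, eq_comm, add_right_comm]

end Pencil

/-! ### The boundary value problem. -/

theorem mainTheorem10 {𝕜 : Type*} [RCLike 𝕜] (n m : ℕ)
    (J R Q : Matrix (Fin n) (Fin n) 𝕜) (B : Matrix (Fin n) (Fin m) 𝕜)
    (S : Matrix (Fin m) (Fin m) 𝕜)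
    (hsys : (J, R, Q, B) ∈ portHamiltonianSystems 𝕜 n m) (hS : S.PosSemidef)
    (μ : 𝕜) (hμ : μ ∉ spectrum 𝕜 ((J - R) * Q) ∪ spectrum 𝕜 (-((J - R) * Q)ᴴ))
    (hreg : IsUnit (μ • pencilE 𝕜 n m - pencilA J R Q B S))
    (t₀ t₁ : ℝ) (ht : t₀ < t₁)
    (E₁ E₂ E₃ E₄ : ℝ → Matrix (Fin n) (Fin n) 𝕜)
    (hE : ∀ t : ℝ, flowMatrix J R Q B S μ (t - t₀) =
      Matrix.fromBlocks (E₁ t) (E₂ t) (E₃ t) (E₄ t))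
    (hE₃ : IsUnit (E₃ t₁)) (xinit xend : Fin n → 𝕜) :
    (∃ (lam x : ℝ → Fin n → 𝕜) (u : ℝ → Fin m → 𝕜),
        IsOptimalityDAESolution J R Q B S t₀ t₁ lam x u ∧ x t₀ = xinit ∧ x t₁ = xend) ↔
      Sum.elim ((E₃ t₁)⁻¹ *ᵥ (xend - E₄ t₁ *ᵥ xinit)) xinit ∈
        LinearMap.range (Matrix.mulVecLin
          (drazinInverse (Nmu J R Q B S μ) * Nmu J R Q B S μ)) := by
  have hdae := pencil_dae_iff J R Q B S μ hμ hreg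
  have hD := drazinInverse_spec (Nmu J R Q B S μ)
  have hdet := (Matrix.isUnit_iff_isUnit_det _).1 hE₃
  constructor
  · rintro ⟨lam, x, u, hsol, rfl, rfl⟩
    set z : ℝ → (Fin n ⊕ Fin n) ⊕ Fin m → 𝕜 :=
      fun t => Sum.elim (Sum.elim (lam t) (x t)) (u t) with hz
    set y : ℝ → Fin n ⊕ Fin n → 𝕜 := fun t => Sum.elim (lam t) (x t) with hy
    set z' := fun t => derivWithin z (Set.Icc t₀ t₁) t with hz'
    have hyd : ∀ t ∈ Set.Icc t₀ t₁,
        HasDerivWithinAt y (fun i => z' t (Sum.inl i)) (Set.Icc t₀ t₁) t := by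
      intro t ht
      have := hsol.contDiff.hasDerivWithinAt ht
      rw [hasDerivWithinAt_pi] at this ⊢
      exact fun i => this (Sum.inl i)
    have hyN : ∀ t ∈ Set.Icc t₀ t₁,
        y t = Nmu J R Q B S μ *ᵥ (μ • y t - fun i => z' t (Sum.inl i)) := by
      intro t ht
      refine ((hdae (y t) (fun i => z' t (Sum.inl i)) (u t) (fun i => z' t (Sum.inr i))).1 ?_).1
      have := hsol.dae t ht
      rwa [← Sum.elim_comp_inl_inr (derivWithin _ _ t)] at this
    have h1 := hD.eq_of_dae ht hyd hyN (Set.right_mem_Icc.2 ht.le)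
    have h0 := hD.proj_mulVec_eq_of_dae ht hyd hyN (Set.left_mem_Icc.2 ht.le)
    change y t₁ = flowMatrix J R Q B S μ (t₁ - t₀) *ᵥ y t₀ at h1
    rw [hE, Matrix.fromBlocks_mulVec] at h1
    have hx : x t₁ = E₃ t₁ *ᵥ lam t₀ + E₄ t₁ *ᵥ x t₀ := funext fun i => congrFun h1 (Sum.inr i)
    rw [hx, add_sub_cancel_right, Matrix.mulVec_mulVec, Matrix.nonsing_inv_mul _ hdet,
      Matrix.one_mulVec]
    exact ⟨y t₀, h0⟩
  · rintro ⟨w, hw⟩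
    set v := Sum.elim ((E₃ t₁)⁻¹ *ᵥ (xend - E₄ t₁ *ᵥ xinit)) xinit with hv
    -- Membership in the image of an idempotent means being fixed by it.
    have hproj : (drazinInverse (Nmu J R Q B S μ) * Nmu J R Q B S μ) *ᵥ v = v := by
      rw [← hw, Matrix.mulVecLin_apply, Matrix.mulVec_mulVec, hD.isIdempotentElem]
    set M := -(drazinInverse (Nmu J R Q B S μ) * (1 - μ • Nmu J R Q B S μ)) with hM
    set y : ℝ → Fin n ⊕ Fin n → 𝕜 :=
      fun t => NormedSpace.exp (((t - t₀ : ℝ) : 𝕜) • M) *ᵥ v with hy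
    have hyd : ∀ t, HasDerivAt y (M *ᵥ y t) t := hasDerivAt_matrix_exp_smul_mulVec M v t₀
    have hyN : ∀ t, y t = Nmu J R Q B S μ *ᵥ (μ • y t - M *ᵥ y t) :=
      fun t => hD.exp_mulVec_dae μ _ hproj
    have hyC : ContDiff ℝ 1 y := contDiff_matrix_exp_smul_mulVec M v t₀
    set L := (Smu J R Q B S μ)⁻¹ * Matrix.fromCols Bᴴ (0 : Matrix (Fin m) (Fin n) 𝕜) *
          Emu J R Q μ * (Matrix.fromBlocks 0 1 (-1) 0 :
            Matrix (Fin n ⊕ Fin n) (Fin n ⊕ Fin n) 𝕜) with hL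
    set u : ℝ → Fin m → 𝕜 := fun t => L *ᵥ (μ • y t - M *ᵥ y t) with hu
    have huC : ContDiff ℝ 1 u := by
      -- With `y' = M y` substituted, `u` is a constant linear image of `y`, so no derivative of `y`
      -- is lost.
      have hu2 : u = fun t => Matrix.mulVecLin (L * (μ • 1 - M)) |>.restrictScalars ℝ
          |>.toContinuousLinearMap (y t) := by
        funext t
        change L *ᵥ (μ • y t - M *ᵥ y t) = (L * (μ • 1 - M)) *ᵥ y t
        rw [← Matrix.mulVec_mulVec _ L, Matrix.sub_mulVec, Matrix.smul_mulVec, Matrix.one_mulVec]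
      rw [hu2]
      exact (ContinuousLinearMap.contDiff _).comp hyC
    have hzeq : (fun t => Sum.elim (Sum.elim (fun i => y t (Sum.inl i))
        (fun i => y t (Sum.inr i))) (u t)) = fun t => Sum.elim (y t) (u t) := by
      funext t
      congr 1
      exact Sum.elim_comp_inl_inr (y t)
    have hzC : ContDiff ℝ 1 (fun t => Sum.elim (y t) (u t)) := by
      rw [contDiff_pi] at hyC huC ⊢
      rintro (i | i)
      · exact hyC i
      · exact huC i
    refine ⟨fun t i => y t (Sum.inl i), fun t i => y t (Sum.inr i), u, ⟨?_, ?_⟩, ?_, ?_⟩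
    · rw [hzeq]
      exact hzC.isC1OnIcc _ _
    · intro t htt
      rw [hzeq, congrFun hzeq t]
      have hd : HasDerivWithinAt (fun t => Sum.elim (y t) (u t))
          (Sum.elim (M *ᵥ y t) (deriv u t)) (Set.Icc t₀ t₁) t := by
        have h1 := hyd t
        have h2 := (huC.differentiable one_ne_zero t).hasDerivAt
        refine HasDerivAt.hasDerivWithinAt ?_
        rw [hasDerivAt_pi] at h1 h2 ⊢
        rintro (i | i)
        · exact h1 i
        · exact h2 i
      rw [hd.derivWithin (uniqueDiffOn_Icc ht t htt)]
      exact (hdae _ _ _ _).2 ⟨hyN t, rfl⟩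
    · funext i
      simp [hy, hv]
    · have h1 : y t₁ = flowMatrix J R Q B S μ (t₁ - t₀) *ᵥ v := rfl
      rw [hE, hv, Matrix.fromBlocks_mulVec] at h1
      funext i
      change y t₁ (Sum.inr i) = _
      rw [h1]
      simp [Function.comp_def, Matrix.mulVec_mulVec, Matrix.mul_nonsing_inv _ hdet]
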